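/- **Setting.** Let $n_1,n_2\ge 1$, and let $A_1\in\mathbb R^{n_1\times n_1}$, $B_1\in\mathbb R^{n_1\times m}$, $A_2\in\mathbb R^{n_2\times n_2}$, $B_2\in\mathbb R^{n_2\times n_1}$. Consider the noisy cascade $$x_1(k+1)=A_1x_1(k)+B_1u_1(k)+d_1(k),\qquad x_2(k+1)=A_2x_2(k)+B_2x_1(k)+d_2(k),$$ with measurements $\bar x_i(k)=x_i(k)+\Delta x_i(k)$, $i=1,2$, and put $$r_1(k)=A_1\Delta x_1(k)-\Delta x_1(k+1)-d_1(k),\qquad r_2(k)=A_2\Delta x_2(k)-\Delta x_2(k+1)+B_2\Delta x_1(k)-d_2(k).$$ For a signal $w$ write $W_-=[w(0)\ \cdots\ w(T-1)]$ and $W_+=[w(1)\ \cdots\ w(T)]$. Let $U_{1,-},\bar X_{1,\pm},\bar X_{2,\pm},R_{1,-},R_{2,-}$ be the data matrices of $u_1,\bar x_1,\bar x_2,r_1,r_2$ along one trajectory of the cascade (the experiment). $\|\cdot\|_2$ denotes the Euclidean norm of vectors and the spectral norm of matrices, $\lambda(\cdot)$ the set of complex eigenvalues, $\operatorname{col}$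 vertical concatenation, $\|G\|_{\mathcal H_\infty}=\sup_{|z|=1}\sigma_{\max}(G(z))$, and a real square matrix is Schur if all its eigenvalues lie in the open unit disc. **Design.** Assume $\operatorname{rank}\begin{bmatrix}\bar X_{1,-}\\U_{1,-}\end{bmatrix}=n_1+m$ and $\operatorname{rank}\begin{bmatrix}\bar X_{2,-}\\\bar X_{1,-}\end{bmatrix}=n_2+n_1$. 1. Let $\alpha_1>0$ satisfy $R_{1,-}R_{1,-}^\top\preceq\frac{\alpha_1^2}{2(2+\alpha_1)}\bar X_{1,+}\bar X_{1,+}^\top$, let $Q_1\in\mathbb R^{T\times n_1}$ satisfy $$\begin{bmatrix}\bar X_{1,-}Q_1-\alpha_1\bar X_{1,+}\bar X_{1,+}^\top&\bar X_{1,+}Q_1\\Q_1^\top\bar X_{1,+}^\top&\bar X_{1,-}Q_1\end{bmatrix}\succ0,\qquad\begin{bmatrix}I&Q_1\\Q_1^\top&\bar X_{1,-}Q_1\end{bmatrix}\succ0$$ (where $\succ 0$ means symmetric positive definite), and let $N_1=U_{1,-}Q_1(\bar X_{1,-}Q_1)^{-1}$. Let $G_{N_1}$ be any matrix with $\bar X_{1,-}G_{N_1}=I$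 and $U_{1,-}G_{N_1}=N_1$. Assume $\lambda(A_1+B_1N_1)\cap\lambda(A_2)=\emptyset$. 2. Let $\hat G$ satisfy $\bar X_{2,+}\hat G=\bar X_{2,-}\hat G\,\bar X_{1,+}G_{N_1}$ and $\bar X_{1,-}\hat G=I$, and put $\hat\Upsilon_c=\bar X_{2,-}\hat G$. 3. Put $\hat Z_\pm=\bar X_{2,\pm}-\hat\Upsilon_c\bar X_{1,\pm}$, $V_-=U_{1,-}-N_1\bar X_{1,-}$ and $$R_{\zeta,-}=R_{2,-}-\bar X_{2,-}\hat GR_{1,-}-R_{2,-}\hat G\bar X_{1,-}+\bar X_{2,-}\hat GR_{1,-}G_{N_1}\bar X_{1,-}.$$ Assume $\operatorname{rank}\begin{bmatrix}\hat Z_-\\V_-\end{bmatrix}=n_2+m$. Let $\alpha_2>0$ satisfy $R_{\zeta,-}R_{\zeta,-}^\top\preceq\frac{\alpha_2^2}{2(2+\alpha_2)}\hat Z_+\hat Z_+^\top$, let $Q_2\in\mathbb R^{T\times n_2}$ satisfy $$\begin{bmatrix}\hat Z_-Q_2-\alpha_2\hat Z_+\hat Z_+^\top&\hat Z_+Q_2\\Q_2^\top\hat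 Z_+^\top&\hat Z_-Q_2\end{bmatrix}\succ0,\qquad\begin{bmatrix}I&Q_2\\Q_2^\top&\hat Z_-Q_2\end{bmatrix}\succ0,$$ and let $N_2=V_-Q_2(\hat Z_-Q_2)^{-1}$. Assume finally that $$\|R_{2,-}\hat G-\bar X_{2,-}\hat GR_{1,-}G_{N_1}\|_2<\frac1{\|\mathcal A_{12}\|_2\,\|(zI-\mathcal A_{11})^{-1}\|_{\mathcal H_\infty}\,\|(zI-\mathcal A_{22})^{-1}\|_{\mathcal H_\infty}}$$ with $\mathcal A_{11}=A_1+B_1N_1$, $\mathcal A_{12}=B_1N_2$, $\mathcal A_{22}=A_2-\hat\Upsilon_cB_1N_2$ (the right-hand side is $+\infty$ if $\mathcal A_{12}=0$). **Theorem.** The Sylvester equation $\Upsilon_c(A_1+B_1N_1)=A_2\Upsilon_c+B_2$ has a unique solution $\Upsilon_c$. With $\Delta\Upsilon_c=\Upsilon_c-\hat\Upsilon_c$, the closed-loop matrix $$\mathcal A=\begin{bmatrix}A_1+B_1N_1&B_1N_2\\\Delta\Upsilon_c(A_1+B_1N_1)-A_2\Delta\Upsilon_c&A_2-\hat\Upsilon_cB_1N_2\end{bmatrix}$$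 is Schur. With $\mathcal B=\begin{bmatrix}-I&0\\\hat\Upsilon_c&-I\end{bmatrix}$, there are constants $c>0$ and $0\le p<1$ such that $\beta(s,k)=c\,p^k s$ is of class $\mathcal{KL}$, $\gamma(s)=\frac{c\|\mathcal B\|_2}{1-p}s$ is of class $\mathcal K$, and every trajectory of the noisy cascade (with arbitrary initial state, system noise and measurement noise) in closed loop with $u_1(k)=N_1\bar x_1(k)+N_2(\bar x_2(k)-\hat\Upsilon_c\bar x_1(k))$ satisfies, for all $k\ge0$, $$\left\|\begin{bmatrix}x_1(k)\\x_2(k)-\hat\Upsilon_cx_1(k)\end{bmatrix}\right\|_2\le\beta\left(\left\|\begin{bmatrix}\bar x_1(0)\\\bar x_2(0)-\hat\Upsilon_c\bar x_1(0)\end{bmatrix}\right\|_2,k\right)+\gamma\Big(\sup_{0\le j\le k-1}\|\operatorname{col}(r_1(j),r_2(j))\|_2\Big)+\left\|\begin{bmatrix}\Delta x_1(k)\\\Delta x_2(k)-\hat\Upsilon_c\Delta x_1(k)\end{bmatrix}\right\|_2 ,$$ where $r_1,r_2$ are formed along that trajectory and the supremum is $0$ for $k=0$. -/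

import Mathlib

open scoped Matrix ENNReal Matrix.Norms.L2Operator

noncomputable section

namespace CascadeISS

/-! The scope `Matrix.Norms.L2Operator` makes `‖M‖` the spectral norm of a real or complex
matrix `M` (and `‖M‖ₑ` the same number in `[0, ∞]`). -/

/-! ### General matrix notions -/

/-- The data matrix `X₋ = [x(0) x(1) ⋯ x(T-1)]` of a signal. -/
def dataMinus {n : ℕ} (T : ℕ) (x : ℕ → Fin n → ℝ) : Matrix (Fin n) (Fin T) ℝ :=
  Matrix.of fun i j => x j i

/-- The data matrix `X₊ = [x(1) x(2) ⋯ x(T)]` of a signal. -/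
def dataPlus {n : ℕ} (T : ℕ) (x : ℕ → Fin n → ℝ) : Matrix (Fin n) (Fin T) ℝ :=
  Matrix.of fun i j => x (j + 1) i

/-- The set of complex eigenvalues of a real square matrix. -/
def eigenvalues {ι : Type*} [Fintype ι] [DecidableEq ι] (A : Matrix ι ι ℝ) : Set ℂ :=
  spectrum ℂ (A.map (algebraMap ℝ ℂ))

/-- All eigenvalues lie in the open unit disc. -/
def IsSchur {ι : Type*} [Fintype ι] [DecidableEq ι] (A : Matrix ι ι ℝ) : Prop :=
  ∀ z ∈ eigenvalues A, ‖z‖ < 1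

/-- `‖G‖_{H∞} = sup_{|z| = 1} σ_max (G z)`, as an element of `[0, ∞]`. -/
def hInfNorm {ι κ : Type*} [Fintype ι] [Fintype κ] [DecidableEq ι] [DecidableEq κ]
    (G : ℂ → Matrix ι κ ℂ) : ℝ≥0∞ :=
  ⨆ z : Metric.sphere (0 : ℂ) 1, ‖G z‖ₑ

/-- The matrix function `z ↦ (zI - A)⁻¹`. -/
def resolventMatrix {ι : Type*} [Fintype ι] [DecidableEq ι] (A : Matrix ι ι ℝ) (z : ℂ) :
    Matrix ι ι ℂ :=
  (z • (1 : Matrix ι ι ℂ) - A.map (algebraMap ℝ ℂ))⁻¹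

/-- The vertical concatenation of two vectors, in the space with the Euclidean norm. -/
def col {n₁ n₂ : ℕ} (v : Fin n₁ → ℝ) (w : Fin n₂ → ℝ) : EuclideanSpace ℝ (Fin n₁ ⊕ Fin n₂) :=
  WithLp.toLp 2 (Sum.elim v w)

/-- `supBefore z k` is the supremum of `‖z(j)‖` over `0 ≤ j ≤ k - 1`
(and `0` for `k = 0`, where there is no such `j`). -/
def supBefore {E : Type*} [Norm E] (z : ℕ → E) (k : ℕ) : ℝ :=
  ⨆ j : Fin k, ‖z j‖

/-! ### Comparison functions -/

/-- Class `K` functions on `[0, ∞)`. -/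
def IsClassK (γ : ℝ → ℝ) : Prop :=
  ContinuousOn γ (Set.Ici 0) ∧ StrictMonoOn γ (Set.Ici 0) ∧ γ 0 = 0

/-- Class `KL` functions on `[0, ∞) × ℤ_{≥ 0}`. -/
def IsClassKL (β : ℝ → ℕ → ℝ) : Prop :=
  (∀ k, IsClassK fun s => β s k) ∧
    ∀ s, 0 ≤ s → Antitone (β s) ∧ Filter.Tendsto (β s) Filter.atTop (nhds 0)

/-! ### The noisy cascade -/

/-- The matrices of the cascade. -/
structure Cascade (n₁ n₂ m : ℕ) where
  A₁ : Matrix (Fin n₁) (Fin n₁) ℝ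
  B₁ : Matrix (Fin n₁) (Fin m) ℝ
  A₂ : Matrix (Fin n₂) (Fin n₂) ℝ
  B₂ : Matrix (Fin n₂) (Fin n₁) ℝ

/-- States `x`, input `u`, system noises `d` and measurement noises `Δx`. -/
structure Signals (n₁ n₂ m : ℕ) where
  x₁ : ℕ → Fin n₁ → ℝ
  x₂ : ℕ → Fin n₂ → ℝ
  u₁ : ℕ → Fin m → ℝ
  d₁ : ℕ → Fin n₁ → ℝ
  d₂ : ℕ → Fin n₂ → ℝ
  Δx₁ : ℕ → Fin n₁ → ℝ
  Δx₂ : ℕ → Fin n₂ → ℝ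

namespace Signals

variable {n₁ n₂ m : ℕ}

/-- The signals obey the equations of the noisy cascade. -/
def IsTrajectory (s : Signals n₁ n₂ m) (S : Cascade n₁ n₂ m) : Prop :=
  ∀ k, s.x₁ (k + 1) = S.A₁ *ᵥ s.x₁ k + S.B₁ *ᵥ s.u₁ k + s.d₁ k ∧
    s.x₂ (k + 1) = S.A₂ *ᵥ s.x₂ k + S.B₂ *ᵥ s.x₁ k + s.d₂ k

/-- The measured first state. -/
def xbar₁ (s : Signals n₁ n₂ m) (k : ℕ) : Fin n₁ → ℝ := s.x₁ k + s.Δx₁ k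

/-- The measured second state. -/
def xbar₂ (s : Signals n₁ n₂ m) (k : ℕ) : Fin n₂ → ℝ := s.x₂ k + s.Δx₂ k

/-- The encapsulated noise of the first subsystem. -/
def r₁ (s : Signals n₁ n₂ m) (S : Cascade n₁ n₂ m) (k : ℕ) : Fin n₁ → ℝ :=
  S.A₁ *ᵥ s.Δx₁ k - s.Δx₁ (k + 1) - s.d₁ k

/-- The encapsulated noise of the second subsystem. -/
def r₂ (s : Signals n₁ n₂ m) (S : Cascade n₁ n₂ m) (k : ℕ) : Fin n₂ → ℝ :=
  S.A₂ *ᵥ s.Δx₂ k - s.Δx₂ (k + 1) + S.B₂ *ᵥ s.Δx₁ k - s.d₂ k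

/-- The input is `u₁ = N₁ x̄₁ + N₂ (x̄₂ - Υ̂ x̄₁)`. -/
def IsControlledBy (s : Signals n₁ n₂ m) (N₁ : Matrix (Fin m) (Fin n₁) ℝ)
    (N₂ : Matrix (Fin m) (Fin n₂) ℝ) (Υhat : Matrix (Fin n₂) (Fin n₁) ℝ) : Prop :=
  ∀ k, s.u₁ k = N₁ *ᵥ s.xbar₁ k + N₂ *ᵥ (s.xbar₂ k - Υhat *ᵥ s.xbar₁ k)

end Signals

/-! ### Data-driven design -/

/-- The signal-to-noise ratio condition `R Rᵀ ⪯ α² / (2 (2 + α)) X₊ X₊ᵀ`. -/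
def SNRCondition {n T : ℕ} (α : ℝ) (R Xp : Matrix (Fin n) (Fin T) ℝ) : Prop :=
  ((α ^ 2 / (2 * (2 + α))) • (Xp * Xpᵀ) - R * Rᵀ).PosSemidef

/-- The two noise-robust linear matrix inequalities in the unknown `Q`. -/
def NoiseRobustLMI {n T : ℕ} (α : ℝ) (Xm Xp : Matrix (Fin n) (Fin T) ℝ)
    (Q : Matrix (Fin T) (Fin n) ℝ) : Prop :=
  (Matrix.fromBlocks (Xm * Q - α • (Xp * Xpᵀ)) (Xp * Q) (Qᵀ * Xpᵀ) (Xm * Q)).PosDef ∧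
    (Matrix.fromBlocks (1 : Matrix (Fin T) (Fin T) ℝ) Q Qᵀ (Xm * Q)).PosDef

/-- The gain `U₋ Q (X₋ Q)⁻¹`. -/
def lmiGain {n m T : ℕ} (Um : Matrix (Fin m) (Fin T) ℝ) (Xm : Matrix (Fin n) (Fin T) ℝ)
    (Q : Matrix (Fin T) (Fin n) ℝ) : Matrix (Fin m) (Fin n) ℝ :=
  Um * Q * (Xm * Q)⁻¹

/-- The noise matrix of the transformed state,
`R₂ - X̄₂ Ĝ R₁ - R₂ Ĝ X̄₁ + X̄₂ Ĝ R₁ G X̄₁`. -/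
def noiseZeta {n₁ n₂ T : ℕ} (X₁ R₁ : Matrix (Fin n₁) (Fin T) ℝ)
    (X₂ R₂ : Matrix (Fin n₂) (Fin T) ℝ) (G Ghat : Matrix (Fin T) (Fin n₁) ℝ) :
    Matrix (Fin n₂) (Fin T) ℝ :=
  R₂ - X₂ * Ghat * R₁ - R₂ * Ghat * X₁ + X₂ * Ghat * R₁ * G * X₁

/-! ### Closed loop -/

/-- `Υ` solves the Sylvester equation `Υ (A₁ + B₁ N₁) = A₂ Υ + B₂`. -/
def IsSylvesterSolution {n₁ n₂ m : ℕ} (S : Cascade n₁ n₂ m) (N₁ : Matrix (Fin m) (Fin n₁) ℝ)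
    (Υ : Matrix (Fin n₂) (Fin n₁) ℝ) : Prop :=
  Υ * (S.A₁ + S.B₁ * N₁) = S.A₂ * Υ + S.B₂

/-- The closed-loop matrix of `col(x̄₁, x̄₂ - Υ̂ x̄₁)`. -/
def closedLoopA {n₁ n₂ m : ℕ} (S : Cascade n₁ n₂ m) (N₁ : Matrix (Fin m) (Fin n₁) ℝ)
    (N₂ : Matrix (Fin m) (Fin n₂) ℝ) (Υ Υhat : Matrix (Fin n₂) (Fin n₁) ℝ) :
    Matrix (Fin n₁ ⊕ Fin n₂) (Fin n₁ ⊕ Fin n₂) ℝ :=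
  Matrix.fromBlocks
    (S.A₁ + S.B₁ * N₁) (S.B₁ * N₂)
    ((Υ - Υhat) * (S.A₁ + S.B₁ * N₁) - S.A₂ * (Υ - Υhat)) (S.A₂ - Υhat * S.B₁ * N₂)

/-- The matrix through which `col(r₁, r₂)` enters the closed loop. -/
def closedLoopB {n₁ n₂ : ℕ} (Υhat : Matrix (Fin n₂) (Fin n₁) ℝ) :
    Matrix (Fin n₁ ⊕ Fin n₂) (Fin n₁ ⊕ Fin n₂) ℝ :=
  Matrix.fromBlocks (-1) 0 Υhat (-1)

end CascadeISS

end

namespace CascadeISS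

open Matrix Filter Topology

/-! ### Spectral norm and complexification -/

/-! The measurements obey the noise-free recursions driven by `-r₁` and `-r₂`, so all noise enters a
known linear system as one additive term. In the coordinates `col(x̄₁, x̄₂ - Υ̂ x̄₁)` the closed
loop has matrix `closedLoopA`. Its diagonal blocks are Schur by design, and its lower left block is
the defect of `Υ̂` in the Sylvester equation.

Both diagonal blocks come from `isSchur_of_noiseRobustLMI`: the two inequalities and the noise bound
make `X₋ Q` a Lyapunov matrix for the unknown true closed loop. It applies twice, since the
transformed data `Ẑ`, `V` again satisfy a linear data equation, with input matrix `-Υ̂ B₁` and noise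
`noiseZeta`.

The data equation for `Ĝ` shows that the defect is exactly `R₂ Ĝ - X̄₂ Ĝ R₁ G`, the quantity bounded
in the gain hypothesis. An eigenvector for an eigenvalue outside the open disc would then be fixed
by a strict contraction (`isSchur_fromBlocks_of_smallGain`). Powers of a Schur matrix decay
geometrically, and variation of constants gives the estimate for the measured state; subtracting the
measurement noise gives it for the true state. -/

theorem norm_toLp_mulVec_le {𝕜 ι κ : Type*} [RCLike 𝕜] [Fintype ι] [Fintype κ] [DecidableEq κ]
    (M : Matrix ι κ 𝕜) (x : κ → 𝕜) :
    ‖WithLp.toLp 2 (M *ᵥ x)‖ ≤ ‖M‖ * ‖WithLp.toLp 2 x‖ :=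
  M.l2_opNorm_mulVec (WithLp.toLp 2 x)

theorem l2_opNorm_le_of_forall {𝕜 ι κ : Type*} [RCLike 𝕜] [Fintype ι] [Fintype κ] [DecidableEq κ]
    (M : Matrix ι κ 𝕜) {C : ℝ} (hC : 0 ≤ C)
    (h : ∀ x : κ → 𝕜, ‖WithLp.toLp 2 (M *ᵥ x)‖ ≤ C * ‖WithLp.toLp 2 x‖) : ‖M‖ ≤ C := by
  rw [Matrix.l2_opNorm_def]
  exact ContinuousLinearMap.opNorm_le_bound _ hC fun x => h x.ofLp

theorem map_ofReal_mulVec_re {ι κ : Type*} [Fintype κ] (M : Matrix ι κ ℝ) (v : κ → ℂ) (i : ι) :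
    ((M.map (algebraMap ℝ ℂ) *ᵥ v) i).re = (M *ᵥ fun j => (v j).re) i := by
  simp [Matrix.mulVec, dotProduct]

theorem map_ofReal_mulVec_im {ι κ : Type*} [Fintype κ] (M : Matrix ι κ ℝ) (v : κ → ℂ) (i : ι) :
    ((M.map (algebraMap ℝ ℂ) *ᵥ v) i).im = (M *ᵥ fun j => (v j).im) i := by
  simp [Matrix.mulVec, dotProduct]

theorem norm_toLp_complex_sq {ι : Type*} [Fintype ι] (v : ι → ℂ) :
    ‖WithLp.toLp 2 v‖ ^ 2 =
      ‖WithLp.toLp 2 fun i => (v i).re‖ ^ 2 + ‖WithLp.toLp 2 fun i => (v i).im‖ ^ 2 := by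
  simp only [EuclideanSpace.norm_sq_eq, ← Finset.sum_add_distrib, Complex.sq_norm,
    Complex.normSq_apply, Real.norm_eq_abs, sq_abs]
  exact Finset.sum_congr rfl fun i _ => by ring

/-- A real matrix acts separately on real and imaginary parts, whose squared norms add. This lets
bounds over `ℂ` (resolvents, Gelfand's formula) be used together with real spectral norms. -/
theorem norm_map_ofReal {ι κ : Type*} [Fintype ι] [Fintype κ] [DecidableEq κ]
    (M : Matrix ι κ ℝ) : ‖M.map (algebraMap ℝ ℂ)‖ = ‖M‖ := by
  apply le_antisymm
  · refine l2_opNorm_le_of_forall _ (norm_nonneg _) fun v => ?_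
    refine abs_le_of_sq_le_sq' ?_ (by positivity) |>.2
    rw [mul_pow, norm_toLp_complex_sq, norm_toLp_complex_sq v, mul_add, ← mul_pow, ← mul_pow]
    simp only [map_ofReal_mulVec_re, map_ofReal_mulVec_im]
    exact add_le_add (pow_le_pow_left₀ (norm_nonneg _) (norm_toLp_mulVec_le M _) 2)
      (pow_le_pow_left₀ (norm_nonneg _) (norm_toLp_mulVec_le M _) 2)
  · refine l2_opNorm_le_of_forall _ (norm_nonneg _) fun x => ?_
    have key := norm_toLp_mulVec_le (M.map (algebraMap ℝ ℂ)) fun j => (x j : ℂ)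
    have h1 : ‖WithLp.toLp 2 fun j => (x j : ℂ)‖ = ‖WithLp.toLp 2 x‖ := by
      simp [EuclideanSpace.norm_eq]
    have h2 : ‖WithLp.toLp 2 (M.map (algebraMap ℝ ℂ) *ᵥ fun j => (x j : ℂ))‖
        = ‖WithLp.toLp 2 (M *ᵥ x)‖ := by
      have : (M.map (algebraMap ℝ ℂ) *ᵥ fun j => (x j : ℂ)) = fun i => ((M *ᵥ x) i : ℂ) := by
        ext i
        simp [Matrix.mulVec, dotProduct]
      rw [this]
      simp [EuclideanSpace.norm_eq]
    rwa [h1, h2] at key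

theorem map_ofReal_pow {ι : Type*} [Fintype ι] [DecidableEq ι] (A : Matrix ι ι ℝ) (k : ℕ) :
    (A ^ k).map (algebraMap ℝ ℂ) = A.map (algebraMap ℝ ℂ) ^ k :=
  map_pow (algebraMap ℝ ℂ).mapMatrix A k

/-! ### Eigenvalues -/

theorem isUnit_sub_of_notMem_eigenvalues {ι : Type*} [Fintype ι] [DecidableEq ι]
    {A : Matrix ι ι ℝ} {z : ℂ} (hz : z ∉ eigenvalues A) :
    IsUnit (z • (1 : Matrix ι ι ℂ) - A.map (algebraMap ℝ ℂ)) := by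
  rw [eigenvalues, spectrum.mem_iff, not_not, Algebra.algebraMap_eq_smul_one] at hz
  exact hz

theorem exists_mulVec_eq_smul {ι : Type*} [Fintype ι] [DecidableEq ι]
    {A : Matrix ι ι ℝ} {z : ℂ} (hz : z ∈ eigenvalues A) :
    ∃ v : ι → ℂ, v ≠ 0 ∧ A.map (algebraMap ℝ ℂ) *ᵥ v = z • v := by
  rw [eigenvalues, spectrum.mem_iff, Algebra.algebraMap_eq_smul_one,
    Matrix.isUnit_iff_isUnit_det, isUnit_iff_ne_zero, not_not] at hz
  obtain ⟨v, hv, h⟩ := Matrix.exists_mulVec_eq_zero_iff.mpr hz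
  refine ⟨v, hv, ?_⟩
  rw [Matrix.sub_mulVec, sub_eq_zero, Matrix.smul_mulVec, Matrix.one_mulVec] at h
  exact h.symm

theorem eigenvalues_transpose {ι : Type*} [Fintype ι] [DecidableEq ι] (A : Matrix ι ι ℝ) :
    eigenvalues Aᵀ = eigenvalues A := by
  ext z
  rw [eigenvalues, eigenvalues, spectrum.mem_iff, spectrum.mem_iff, Matrix.transpose_map,
    Matrix.isUnit_iff_isUnit_det, Matrix.isUnit_iff_isUnit_det, ← Matrix.det_transpose]
  simp [Algebra.algebraMap_eq_smul_one]

theorem mem_eigenvalues_of_aeval_charpoly_eq_zero {ι : Type*} [Fintype ι] [DecidableEq ι]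
    {A : Matrix ι ι ℝ} {z : ℂ} (hz : Polynomial.aeval z A.charpoly = 0) : z ∈ eigenvalues A := by
  rw [eigenvalues, Matrix.mem_spectrum_iff_isRoot_charpoly, Matrix.charpoly_map,
    Polynomial.IsRoot, Polynomial.eval_map_algebraMap, hz]

/-- A discrete-time Lyapunov criterion. -/
theorem isSchur_of_posDef_sub {ι : Type*} [Fintype ι] [DecidableEq ι] {F P : Matrix ι ι ℝ}
    (hP : P.PosDef) (h : (P - F * P * Fᵀ).PosDef) : IsSchur F := by
  intro z hz
  -- The form of `P - F P Fᵀ` at `u` involves `Fᵀ u`, so an eigenvector of `Fᵀ` is needed. Adding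
  -- the values at its real and imaginary parts cancels the cross terms and leaves the factor `1 -
  -- |z|²`.
  rw [← eigenvalues_transpose] at hz
  obtain ⟨v, hv, hFv⟩ := exists_mulVec_eq_smul hz
  set a : ι → ℝ := fun j => (v j).re with ha
  set b : ι → ℝ := fun j => (v j).im with hb
  have hFa : Fᵀ *ᵥ a = z.re • a - z.im • b := by
    ext i
    rw [ha, ← map_ofReal_mulVec_re, hFv]
    simp [hb]
  have hFb : Fᵀ *ᵥ b = z.re • b + z.im • a := by
    ext i
    rw [hb, ← map_ofReal_mulVec_im, hFv]
    simp [ha]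
  have hq (u : ι → ℝ) : u ⬝ᵥ (P - F * P * Fᵀ) *ᵥ u
      = u ⬝ᵥ P *ᵥ u - (Fᵀ *ᵥ u) ⬝ᵥ P *ᵥ (Fᵀ *ᵥ u) := by
    rw [Matrix.sub_mulVec, dotProduct_sub, ← Matrix.mulVec_mulVec, ← Matrix.mulVec_mulVec,
      Matrix.dotProduct_mulVec u F, ← Matrix.mulVec_transpose]
  have hsymm : b ⬝ᵥ P *ᵥ a = a ⬝ᵥ P *ᵥ b := by
    have : Pᵀ = P := by simpa using hP.isHermitian.eq
    rw [Matrix.dotProduct_mulVec, ← Matrix.mulVec_transpose, this, dotProduct_comm]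
  have hab : a ≠ 0 ∨ b ≠ 0 := by
    by_contra! hcon
    apply hv
    ext i
    exact Complex.ext (congrFun hcon.1 i) (congrFun hcon.2 i)
  have hpos (M : Matrix ι ι ℝ) (hM : M.PosDef) : 0 < a ⬝ᵥ M *ᵥ a + b ⬝ᵥ M *ᵥ b := by
    have hn (u : ι → ℝ) : 0 ≤ u ⬝ᵥ M *ᵥ u := by
      simpa using hM.posSemidef.dotProduct_mulVec_nonneg u
    have hp (u : ι → ℝ) (hu : u ≠ 0) : 0 < u ⬝ᵥ M *ᵥ u := by
      simpa using hM.dotProduct_mulVec_pos hu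
    rcases hab with h0 | h0
    · exact add_pos_of_pos_of_nonneg (hp a h0) (hn b)
    · exact add_pos_of_nonneg_of_pos (hn a) (hp b h0)
  have h1 := hpos P hP
  have h2 := hpos _ h
  rw [hq, hq, hFa, hFb] at h2
  simp only [Matrix.mulVec_sub, Matrix.mulVec_add, Matrix.mulVec_smul, dotProduct_sub,
    dotProduct_add, sub_dotProduct, add_dotProduct, dotProduct_smul, smul_dotProduct,
    smul_eq_mul, hsymm] at h2
  have h3 : 0 < (1 - (z.re * z.re + z.im * z.im)) * (a ⬝ᵥ P *ᵥ a + b ⬝ᵥ P *ᵥ b) := by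
    linear_combination h2
  have h4 := pos_of_mul_pos_left h3 h1.le
  rw [← sq_lt_one_iff₀ (norm_nonneg z), Complex.sq_norm, Complex.normSq_apply]
  linarith

/-! ### Noise-robust stabilization from data -/

theorem posDef_schurComplement₂₂ {ι κ : Type*} [Fintype ι] [Fintype κ] [DecidableEq ι]
    [DecidableEq κ] {A : Matrix ι ι ℝ} {B : Matrix ι κ ℝ} {D : Matrix κ κ ℝ} (hD : IsUnit D)
    (h : (Matrix.fromBlocks A B Bᵀ D).PosDef) : (A - B * D⁻¹ * Bᵀ).PosDef := by
  have hdet := (Matrix.isUnit_iff_isUnit_det D).mp hD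
  -- Congruence by this block column eliminates the off-diagonal blocks; it is injective because its
  -- top block is the identity.
  let C : Matrix (ι ⊕ κ) ι ℝ := Matrix.fromRows 1 (-(D⁻¹ * Bᵀ))
  have hC : Function.Injective C.mulVec := by
    intro u w huw
    ext i
    simpa [C, Matrix.fromRows_mulVec] using congrFun huw (Sum.inl i)
  have key := h.conjTranspose_mul_mul_same hC
  convert key using 1
  simp only [C, Matrix.mul_assoc, Matrix.fromBlocks_mul_fromRows,
    Matrix.conjTranspose_eq_transpose_of_trivial, Matrix.transpose_fromRows,
    Matrix.fromCols_mul_fromRows]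
  simp [Matrix.mul_nonsing_inv_cancel_left _ _ hdet, sub_eq_add_neg]

/-- With `P = X₋ Q` and `M = Q P⁻¹ Qᵀ`, the data equation gives `F P Fᵀ = (X₊ + R) M (X₊ + R)ᵀ` for
the true closed loop `F`. Schur complements turn the inequalities into `M ⪯ I` and `P - α X₊ X₊ᵀ -
X₊ M X₊ᵀ ≻ 0`; the margin `α X₊ X₊ᵀ` pays for the noise. -/
theorem isSchur_of_noiseRobustLMI {n m T : ℕ} {A : Matrix (Fin n) (Fin n) ℝ}
    {B : Matrix (Fin n) (Fin m) ℝ} {Xm Xp R : Matrix (Fin n) (Fin T) ℝ}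
    {U : Matrix (Fin m) (Fin T) ℝ} (hdata : Xp = A * Xm + B * U - R) {α : ℝ} (hα : 0 < α)
    (hSNR : SNRCondition α R Xp) {Q : Matrix (Fin T) (Fin n) ℝ} (hQ : NoiseRobustLMI α Xm Xp Q) :
    IsSchur (A + B * lmiGain U Xm Q) := by
  obtain ⟨h1, h2⟩ := hQ
  set P := Xm * Q with hPdef
  have hP : P.PosDef := h2.submatrix Sum.inr_injective
  have hPT : Pᵀ = P := by simpa using hP.isHermitian.eq
  have hdet := (Matrix.isUnit_iff_isUnit_det P).mp hP.isUnit
  set M := Q * P⁻¹ * Qᵀ with hM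
  have hM0 : M.PosSemidef := by
    simpa using hP.inv.posSemidef.mul_mul_conjTranspose_same Q
  have hM1 : (1 - M).PosSemidef := (posDef_schurComplement₂₂ hP.isUnit h2).posSemidef
  have hS : (P - α • (Xp * Xpᵀ) - Xp * M * Xpᵀ).PosDef := by
    rw [← Matrix.transpose_mul] at h1
    convert posDef_schurComplement₂₂ hP.isUnit h1 using 2
    simp [hM, Matrix.mul_assoc]
  have hFP : (A + B * lmiGain U Xm Q) * P = (Xp + R) * Q := by
    rw [lmiGain, ← hPdef, Matrix.add_mul, Matrix.mul_assoc, Matrix.mul_assoc,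
      Matrix.nonsing_inv_mul _ hdet, Matrix.mul_one, hdata, hPdef]
    simp [Matrix.add_mul, Matrix.mul_assoc]
  refine isSchur_of_posDef_sub hP ?_
  have hFPF : (A + B * lmiGain U Xm Q) * P * (A + B * lmiGain U Xm Q)ᵀ
      = (Xp + R) * M * (Xp + R)ᵀ := by
    have : (A + B * lmiGain U Xm Q) * P * (A + B * lmiGain U Xm Q)ᵀ
        = ((A + B * lmiGain U Xm Q) * P) * P⁻¹ * ((A + B * lmiGain U Xm Q) * P)ᵀ := by
      rw [Matrix.mul_nonsing_inv_cancel_right _ _ hdet, Matrix.transpose_mul, hPT,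
        Matrix.mul_assoc]
    rw [this, hFP, Matrix.transpose_mul, hM]
    simp [Matrix.mul_assoc]
  -- `P - F P Fᵀ` is the sum of `hS` and these four terms. `e3` is Young's inequality for the cross
  -- terms, at the price `(α / 2) X₊ M X₊ᵀ + (2 / α) R M Rᵀ`; `e1` and `e2` replace `M` by `I`. The
  -- noise bound is scaled by `1 + 2 / α` in `e4`, which makes its right side `(α / 2) X₊ X₊ᵀ`.
  have e1 : ((α / 2) • (Xp * (1 - M) * Xpᵀ)).PosSemidef :=
    (by simpa using hM1.mul_mul_conjTranspose_same Xp :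
      (Xp * (1 - M) * Xpᵀ).PosSemidef).smul (by positivity)
  have e2 : ((1 + 2 / α) • (R * (1 - M) * Rᵀ)).PosSemidef :=
    (by simpa using hM1.mul_mul_conjTranspose_same R :
      (R * (1 - M) * Rᵀ).PosSemidef).smul (by positivity)
  have e3 : ((α / 2) • ((Xp - (2 / α) • R) * M * (Xp - (2 / α) • R)ᵀ)).PosSemidef := by
    refine Matrix.PosSemidef.smul ?_ (by positivity)
    rw [← Matrix.conjTranspose_eq_transpose_of_trivial]
    exact hM0.mul_mul_conjTranspose_same (Xp - (2 / α) • R)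
  have e4 : ((1 + 2 / α) • ((α ^ 2 / (2 * (2 + α))) • (Xp * Xpᵀ) - R * Rᵀ)).PosSemidef :=
    Matrix.PosSemidef.smul hSNR (by positivity)
  have hsum := hS.add_posSemidef (((e1.add e2).add e3).add e4)
  rw [hFPF]
  convert hsum using 1
  simp only [Matrix.mul_sub, Matrix.sub_mul, Matrix.mul_add, Matrix.add_mul, Matrix.transpose_sub,
    Matrix.transpose_add, Matrix.transpose_smul, Matrix.smul_mul, Matrix.mul_smul, Matrix.mul_one]
  match_scalars <;> field_simp <;> ring

/-! ### The Sylvester equation -/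

open Polynomial in
theorem aeval_mul_eq_mul_aeval {ι κ : Type*} [Fintype ι] [Fintype κ] [DecidableEq ι]
    [DecidableEq κ] {F : Matrix ι ι ℝ} {A : Matrix κ κ ℝ} {X : Matrix κ ι ℝ}
    (h : X * F = A * X) (p : ℝ[X]) : X * aeval F p = aeval A p * X := by
  induction p using Polynomial.induction_on' with
  | add p q hp hq => simp [Matrix.mul_add, Matrix.add_mul, hp, hq]
  | monomial k a =>
    have hk : X * F ^ k = A ^ k * X := by
      induction k with
      | zero => simp
      | succ k ih => rw [pow_succ, ← Matrix.mul_assoc, ih, Matrix.mul_assoc, h, pow_succ,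
          Matrix.mul_assoc]
    simp [aeval_monomial, Algebra.algebraMap_eq_smul_one, hk]

/-- The characteristic polynomials have no common complex root, hence are coprime. By
Cayley–Hamilton, Bézout's identity makes `χ_F(A)` invertible, while intertwining gives `χ_F(A) X = X
χ_F(F) = 0`. -/
theorem eq_zero_of_mul_eq_mul {ι κ : Type*} [Fintype ι] [Fintype κ] [DecidableEq ι]
    [DecidableEq κ] {F : Matrix ι ι ℝ} {A : Matrix κ κ ℝ} {X : Matrix κ ι ℝ}
    (hd : Disjoint (eigenvalues F) (eigenvalues A)) (h : X * F = A * X) : X = 0 := by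
  have hcop : IsCoprime F.charpoly A.charpoly := by
    refine (Polynomial.isCoprime_iff_aeval_ne_zero_of_isAlgClosed ℝ ℂ _ _).mpr fun z => ?_
    by_contra! hz
    exact Set.disjoint_left.mp hd (mem_eigenvalues_of_aeval_charpoly_eq_zero hz.1)
      (mem_eigenvalues_of_aeval_charpoly_eq_zero hz.2)
  obtain ⟨p, q, hpq⟩ := hcop
  have h1 := congrArg (Polynomial.aeval A) hpq
  simp only [map_add, map_mul, map_one, Matrix.aeval_self_charpoly, mul_zero, add_zero] at h1
  have h2 := aeval_mul_eq_mul_aeval h F.charpoly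
  rw [Matrix.aeval_self_charpoly, Matrix.mul_zero] at h2
  rw [← Matrix.one_mul X, ← h1, Matrix.mul_assoc, ← h2, Matrix.mul_zero]

/-- The map `X ↦ X F - A X` is an injective endomorphism of a finite-dimensional space, hence
bijective. -/
theorem existsUnique_sylvester {ι κ : Type*} [Fintype ι] [Fintype κ] [DecidableEq ι]
    [DecidableEq κ] {F : Matrix ι ι ℝ} {A : Matrix κ κ ℝ}
    (hd : Disjoint (eigenvalues F) (eigenvalues A)) (C : Matrix κ ι ℝ) :
    ∃! X : Matrix κ ι ℝ, X * F = A * X + C := by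
  let L : Matrix κ ι ℝ →ₗ[ℝ] Matrix κ ι ℝ :=
    { toFun := fun X => X * F - A * X
      map_add' := fun X Y => by rw [Matrix.add_mul, Matrix.mul_add]; abel
      map_smul' := fun a X => by simp [smul_sub] }
  have hinj : Function.Injective L := by
    rw [injective_iff_map_eq_zero]
    exact fun X hX => eq_zero_of_mul_eq_mul hd (sub_eq_zero.mp hX)
  have hiff (X : Matrix κ ι ℝ) : X * F = A * X + C ↔ L X = C := by
    change _ ↔ X * F - A * X = C
    rw [sub_eq_iff_eq_add']
  simp only [hiff]
  exact Function.Bijective.existsUnique ⟨hinj, LinearMap.injective_iff_surjective.mp hinj⟩ C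

/-! ### Schur matrices: resolvents and powers -/

theorem IsSchur.isUnit_sub {ι : Type*} [Fintype ι] [DecidableEq ι] {A : Matrix ι ι ℝ}
    (hA : IsSchur A) {z : ℂ} (hz : 1 ≤ ‖z‖) :
    IsUnit (z • (1 : Matrix ι ι ℂ) - A.map (algebraMap ℝ ℂ)) :=
  isUnit_sub_of_notMem_eigenvalues fun h => (hA z h).not_ge hz

theorem IsSchur.isUnit_one_sub {ι : Type*} [Fintype ι] [DecidableEq ι] {A : Matrix ι ι ℝ}
    (hA : IsSchur A) {w : ℂ} (hw : ‖w‖ ≤ 1) :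
    IsUnit ((1 : Matrix ι ι ℂ) - w • A.map (algebraMap ℝ ℂ)) := by
  rcases eq_or_ne w 0 with rfl | h0
  · simp
  have hz : 1 ≤ ‖w⁻¹‖ := by
    rw [norm_inv]
    exact (one_le_inv₀ (norm_pos_iff.mpr h0)).mpr hw
  have := (hA.isUnit_sub hz).smul (Units.mk0 w h0)
  rwa [Units.smul_mk0, smul_sub, smul_smul, mul_inv_cancel₀ h0, one_smul] at this

/-- The maximum principle for the resolvent of a Schur matrix outside the unit disc. -/
theorem IsSchur.enorm_resolventMatrix_le {ι : Type*} [Fintype ι] [DecidableEq ι]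
    {A : Matrix ι ι ℝ} (hA : IsSchur A) {z : ℂ} (hz : 1 ≤ ‖z‖) :
    ‖resolventMatrix A z‖ₑ ≤ hInfNorm (resolventMatrix A) := by
  rcases eq_or_ne (hInfNorm (resolventMatrix A)) ⊤ with htop | htop
  · simp [htop]
  -- The substitution `w = z⁻¹` moves the exterior of the disc inside; this formula extends the
  -- resolvent analytically across `w = 0`, the image of infinity.
  let f : ℂ → Matrix ι ι ℂ := fun w => w • ((1 : Matrix ι ι ℂ) - w • A.map (algebraMap ℝ ℂ))⁻¹
  have hf {w : ℂ} (h0 : w ≠ 0) (hw : ‖w‖ ≤ 1) : f w = resolventMatrix A w⁻¹ := by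
    have hdet := (Matrix.isUnit_iff_isUnit_det _).mp (hA.isUnit_one_sub hw)
    have hmul : w⁻¹ • (1 : Matrix ι ι ℂ) - A.map (algebraMap ℝ ℂ)
        = w⁻¹ • ((1 : Matrix ι ι ℂ) - w • A.map (algebraMap ℝ ℂ)) := by
      rw [smul_sub, smul_smul, inv_mul_cancel₀ h0, one_smul]
    refine (Matrix.inv_eq_right_inv ?_).symm
    rw [hmul, Matrix.smul_mul, Matrix.mul_smul, Matrix.mul_nonsing_inv _ hdet, smul_smul,
      inv_mul_cancel₀ h0, one_smul]
  have hdiff : DiffContOnCl ℂ f (Metric.ball 0 1) := by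
    apply DifferentiableOn.diffContOnCl
    rw [closure_ball _ one_ne_zero]
    intro w hw
    have hw1 : ‖w‖ ≤ 1 := by simpa using hw
    have hu := hA.isUnit_one_sub hw1
    refine DifferentiableAt.differentiableWithinAt ?_
    simp only [f, Matrix.nonsing_inv_eq_ringInverse]
    have h1 : DifferentiableAt ℂ
        (fun w : ℂ => (1 : Matrix ι ι ℂ) - w • A.map (algebraMap ℝ ℂ)) w := by fun_prop
    have h2 : DifferentiableAt ℂ
        (fun w : ℂ => Ring.inverse ((1 : Matrix ι ι ℂ) - w • A.map (algebraMap ℝ ℂ))) w :=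
      DifferentiableAt.comp (g := Ring.inverse) w (differentiableAt_inverse (𝕜 := ℂ) hu) h1
    exact differentiableAt_fun_id.fun_smul h2
  have hfront (w : ℂ) (hw : w ∈ frontier (Metric.ball (0 : ℂ) 1)) :
      ‖f w‖ ≤ (hInfNorm (resolventMatrix A)).toReal := by
    rw [frontier_ball _ one_ne_zero, mem_sphere_zero_iff_norm] at hw
    have h0 : w ≠ 0 := norm_ne_zero_iff.mp (by simp [hw])
    rw [hf h0 hw.le, ← toReal_enorm]
    refine ENNReal.toReal_mono htop ?_
    exact le_iSup (fun z : Metric.sphere (0 : ℂ) 1 => ‖resolventMatrix A z‖ₑ)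
      ⟨w⁻¹, by simp [hw]⟩
  have h0 : z ≠ 0 := norm_ne_zero_iff.mp (by linarith)
  have hz' : z⁻¹ ∈ closure (Metric.ball (0 : ℂ) 1) := by
    rw [closure_ball _ one_ne_zero, mem_closedBall_zero_iff, norm_inv]
    exact inv_le_one_of_one_le₀ hz
  have key := Complex.norm_le_of_forall_mem_frontier_norm_le Metric.isBounded_ball hdiff hfront hz'
  rw [hf (inv_ne_zero h0) (by rw [norm_inv]; exact inv_le_one_of_one_le₀ hz), inv_inv, ← toReal_enorm] at key
  exact (ENNReal.toReal_le_toReal enorm_ne_top htop).mp key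

theorem IsSchur.exists_norm_pow_le {ι : Type*} [Fintype ι] [DecidableEq ι] [Nonempty ι]
    {A : Matrix ι ι ℝ} (hA : IsSchur A) :
    ∃ c p : ℝ, 0 < c ∧ 0 < p ∧ p < 1 ∧ ∀ k : ℕ, ‖A ^ k‖ ≤ c * p ^ k := by
  have hrad : spectralRadius ℂ (A.map (algebraMap ℝ ℂ)) < (1 : NNReal) :=
    spectrum.spectralRadius_lt_of_forall_lt _ fun z hz => hA z hz
  -- By Gelfand's formula any `p` between the spectral radius and `1` works eventually. It is
  -- positive even for nilpotent `A`, which strict monotonicity of `β` in its first argument needs.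
  obtain ⟨p, hp1, hp2⟩ := ENNReal.lt_iff_exists_nnreal_btwn.mp hrad
  have hp0 : 0 < p := by
    exact_mod_cast (zero_le.trans_lt hp1 : (0 : ℝ≥0∞) < p)
  have hev := (spectrum.pow_nnnorm_pow_one_div_tendsto_nhds_spectralRadius
    (A.map (algebraMap ℝ ℂ))).eventually_lt_const hp1
  obtain ⟨K, hK⟩ := eventually_atTop.mp hev
  have hp0' : (0 : ℝ) < p := hp0
  -- The sum absorbs the finitely many exponents up to `K`; the `1` serves the remaining ones, which
  -- are positive, so the `k`-th root can be undone.
  refine ⟨1 + ∑ k ∈ Finset.range (K + 1), ‖A ^ k‖ / p ^ k, p, by positivity, hp0',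
    by exact_mod_cast hp2, fun k => ?_⟩
  have hsum : 0 ≤ ∑ k ∈ Finset.range (K + 1), ‖A ^ k‖ / (p : ℝ) ^ k := by positivity
  rcases lt_or_ge k (K + 1) with hk | hk
  · rw [← div_le_iff₀ (by positivity)]
    refine le_add_of_nonneg_of_le zero_le_one ?_
    exact Finset.single_le_sum (f := fun k => ‖A ^ k‖ / (p : ℝ) ^ k) (fun i _ => by positivity)
      (Finset.mem_range.mpr hk)
  · have hk0 : (0 : ℝ) < k := by exact_mod_cast (by omega : 0 < k)
    have h1 := hK k (by omega)
    rw [one_div, ENNReal.rpow_inv_lt_iff hk0, ENNReal.rpow_natCast] at h1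
    have h2 : ‖A.map (algebraMap ℝ ℂ) ^ k‖ < (p : ℝ) ^ k := by exact_mod_cast h1
    rw [← map_ofReal_pow, norm_map_ofReal] at h2
    nlinarith [pow_pos hp0' k]

/-! ### A small-gain theorem -/

theorem eq_zero_of_mulVec_eq_self {ι : Type*} [Fintype ι] [DecidableEq ι] {M : Matrix ι ι ℂ}
    (hM : ‖M‖ₑ < 1) {v : ι → ℂ} (hv : M *ᵥ v = v) : v = 0 := by
  have hM' : ‖M‖ < 1 := by
    rw [← toReal_enorm]
    exact (ENNReal.toReal_lt_toReal enorm_ne_top ENNReal.one_ne_top).mpr hM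
  have h := norm_toLp_mulVec_le M v
  rw [hv] at h
  have h0 : ‖WithLp.toLp 2 v‖ = 0 := by nlinarith [norm_nonneg (WithLp.toLp 2 v)]
  simpa using h0

theorem l2_opENorm_mul {𝕜 ι κ l : Type*} [RCLike 𝕜] [Fintype ι] [Fintype κ] [Fintype l]
    [DecidableEq κ] [DecidableEq l] (M : Matrix ι κ 𝕜) (N : Matrix κ l 𝕜) :
    ‖M * N‖ₑ ≤ ‖M‖ₑ * ‖N‖ₑ := by
  simp only [enorm_eq_nnnorm]
  exact_mod_cast Matrix.l2_opNNNorm_mul M N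

/-- If `|z| ≥ 1`, the two block rows of the eigenvector equation can be solved by resolvents, so
`v₁` is fixed by `(z - A)⁻¹ B (z - D)⁻¹ C`. The maximum principle bounds its norm by the loop gain,
which is below one. -/
theorem isSchur_fromBlocks_of_smallGain {ι κ : Type*} [Fintype ι] [Fintype κ] [DecidableEq ι]
    [DecidableEq κ] {A : Matrix ι ι ℝ} {B : Matrix ι κ ℝ} {C : Matrix κ ι ℝ} {D : Matrix κ κ ℝ}
    (hA : IsSchur A) (hD : IsSchur D)
    (hgain : ‖C‖ₑ * (‖B‖ₑ * hInfNorm (resolventMatrix A) * hInfNorm (resolventMatrix D)) < 1) :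
    IsSchur (Matrix.fromBlocks A B C D) := by
  intro z hz
  by_contra! hz1
  obtain ⟨v, hv, hev⟩ := exists_mulVec_eq_smul hz
  rw [Matrix.fromBlocks_map, Matrix.fromBlocks_mulVec] at hev
  set v₁ := v ∘ Sum.inl with hv₁
  set v₂ := v ∘ Sum.inr with hv₂
  have e₁ : A.map (algebraMap ℝ ℂ) *ᵥ v₁ + B.map (algebraMap ℝ ℂ) *ᵥ v₂ = z • v₁ :=
    funext fun i => congrFun hev (Sum.inl i)
  have e₂ : C.map (algebraMap ℝ ℂ) *ᵥ v₁ + D.map (algebraMap ℝ ℂ) *ᵥ v₂ = z • v₂ :=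
    funext fun i => congrFun hev (Sum.inr i)
  have hdetA := (Matrix.isUnit_iff_isUnit_det _).mp (hA.isUnit_sub hz1)
  have hdetD := (Matrix.isUnit_iff_isUnit_det _).mp (hD.isUnit_sub hz1)
  have f₁ : v₁ = resolventMatrix A z *ᵥ (B.map (algebraMap ℝ ℂ) *ᵥ v₂) := by
    rw [← add_sub_cancel_left (A.map (algebraMap ℝ ℂ) *ᵥ v₁) (B.map (algebraMap ℝ ℂ) *ᵥ v₂), e₁]
    nth_rw 2 [← Matrix.one_mulVec v₁]
    rw [← Matrix.smul_mulVec, ← Matrix.sub_mulVec, Matrix.mulVec_mulVec, resolventMatrix,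
      Matrix.nonsing_inv_mul _ hdetA, Matrix.one_mulVec]
  have f₂ : v₂ = resolventMatrix D z *ᵥ (C.map (algebraMap ℝ ℂ) *ᵥ v₁) := by
    rw [← add_sub_cancel_right (C.map (algebraMap ℝ ℂ) *ᵥ v₁) (D.map (algebraMap ℝ ℂ) *ᵥ v₂), e₂]
    nth_rw 2 [← Matrix.one_mulVec v₂]
    rw [← Matrix.smul_mulVec, ← Matrix.sub_mulVec, Matrix.mulVec_mulVec, resolventMatrix,
      Matrix.nonsing_inv_mul _ hdetD, Matrix.one_mulVec]
  have hfix : (resolventMatrix A z * (B.map (algebraMap ℝ ℂ) *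
      (resolventMatrix D z * C.map (algebraMap ℝ ℂ)))) *ᵥ v₁ = v₁ := by
    simp only [← Matrix.mulVec_mulVec]
    rw [← f₂, ← f₁]
  have hB : ‖B.map (algebraMap ℝ ℂ)‖ₑ = ‖B‖ₑ := by
    rw [← ofReal_norm, norm_map_ofReal, ofReal_norm]
  have hC : ‖C.map (algebraMap ℝ ℂ)‖ₑ = ‖C‖ₑ := by
    rw [← ofReal_norm, norm_map_ofReal, ofReal_norm]
  have hlt : ‖resolventMatrix A z * (B.map (algebraMap ℝ ℂ) *
      (resolventMatrix D z * C.map (algebraMap ℝ ℂ)))‖ₑ < 1 := by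
    refine lt_of_le_of_lt ?_ hgain
    calc _ ≤ ‖resolventMatrix A z‖ₑ * (‖B.map (algebraMap ℝ ℂ)‖ₑ *
          (‖resolventMatrix D z‖ₑ * ‖C.map (algebraMap ℝ ℂ)‖ₑ)) :=
          (l2_opENorm_mul _ _).trans <| mul_le_mul_right ((l2_opENorm_mul _ _).trans <|
            mul_le_mul_right (l2_opENorm_mul _ _) _) _
      _ ≤ hInfNorm (resolventMatrix A) * (‖B‖ₑ * (hInfNorm (resolventMatrix D) * ‖C‖ₑ)) := by
          rw [hB, hC]
          gcongr
          · exact hA.enorm_resolventMatrix_le hz1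
          · exact hD.enorm_resolventMatrix_le hz1
      _ = _ := by ring
  have z₁ := eq_zero_of_mulVec_eq_self hlt hfix
  have z₂ : v₂ = 0 := by rw [f₂, z₁, Matrix.mulVec_zero, Matrix.mulVec_zero]
  apply hv
  ext i
  rcases i with i | i
  · exact congrFun z₁ i
  · exact congrFun z₂ i

/-- The case `b = 0`, where `1 / b = ∞`, covers vanishing coupling `B₁ N₂`. -/
theorem mul_lt_one_of_lt_one_div {a b : ℝ≥0∞} (h : a < 1 / b) : a * b < 1 := by
  rcases eq_or_ne b 0 with rfl | hb
  · simp
  rcases eq_or_ne b ⊤ with rfl | hb'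
  · simp at h
  exact (ENNReal.lt_div_iff_mul_lt (Or.inl hb) (Or.inl hb')).mp h

/-! ### Data identities of the noisy cascade -/

namespace Signals

variable {n₁ n₂ m : ℕ} {s : Signals n₁ n₂ m} {S : Cascade n₁ n₂ m}

theorem IsTrajectory.xbar₁_succ (hs : s.IsTrajectory S) (k : ℕ) :
    s.xbar₁ (k + 1) = S.A₁ *ᵥ s.xbar₁ k + S.B₁ *ᵥ s.u₁ k - s.r₁ S k := by
  rw [xbar₁, (hs k).1, xbar₁, r₁, Matrix.mulVec_add]
  abel

theorem IsTrajectory.xbar₂_succ (hs : s.IsTrajectory S) (k : ℕ) :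
    s.xbar₂ (k + 1) = S.A₂ *ᵥ s.xbar₂ k + S.B₂ *ᵥ s.xbar₁ k - s.r₂ S k := by
  rw [xbar₂, (hs k).2, xbar₂, xbar₁, r₂, Matrix.mulVec_add, Matrix.mulVec_add]
  abel

theorem IsTrajectory.dataPlus_xbar₁ (hs : s.IsTrajectory S) (T : ℕ) :
    dataPlus T s.xbar₁ = S.A₁ * dataMinus T s.xbar₁ + S.B₁ * dataMinus T s.u₁
      - dataMinus T (s.r₁ S) :=
  Matrix.ext fun i j => congrFun (hs.xbar₁_succ j) i

theorem IsTrajectory.dataPlus_xbar₂ (hs : s.IsTrajectory S) (T : ℕ) :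
    dataPlus T s.xbar₂ = S.A₂ * dataMinus T s.xbar₂ + S.B₂ * dataMinus T s.xbar₁
      - dataMinus T (s.r₂ S) :=
  Matrix.ext fun i j => congrFun (hs.xbar₂_succ j) i

end Signals

/-! ### Input-to-state estimates -/

theorem norm_le_supBefore {E : Type*} [Norm E] (z : ℕ → E) {j k : ℕ} (hj : j < k) :
    ‖z j‖ ≤ supBefore z k :=
  le_ciSup (f := fun j : Fin k => ‖z j‖) (Set.finite_range _).bddAbove ⟨j, hj⟩

theorem supBefore_nonneg {E : Type*} [SeminormedAddGroup E] (z : ℕ → E) (k : ℕ) :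
    0 ≤ supBefore z k :=
  Real.iSup_nonneg fun _ => norm_nonneg _

theorem eq_pow_mulVec_add_sum {ι κ : Type*} [Fintype ι] [Fintype κ] [DecidableEq ι]
    {A : Matrix ι ι ℝ} {B : Matrix ι κ ℝ} {x : ℕ → ι → ℝ} {r : ℕ → κ → ℝ}
    (h : ∀ k, x (k + 1) = A *ᵥ x k + B *ᵥ r k) (k : ℕ) :
    x k = A ^ k *ᵥ x 0 + ∑ j ∈ Finset.range k, A ^ (k - 1 - j) *ᵥ (B *ᵥ r j) := by
  induction k with
  | zero => simp
  | succ k ih =>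
    rw [h, ih, Matrix.mulVec_add, Matrix.mulVec_mulVec, ← pow_succ', Finset.sum_range_succ,
      ← Matrix.mulVecLin_apply A, map_sum, add_assoc]
    congr 2
    · refine Finset.sum_congr rfl fun j hj => ?_
      have := Finset.mem_range.mp hj
      rw [Matrix.mulVecLin_apply, Matrix.mulVec_mulVec, ← pow_succ']
      congr 2
      omega
    · simp

/-- Variation of constants, with each input bounded by the supremum and the geometric sum by `1 / (1
- p)`. -/
theorem norm_le_of_linear_recursion {ι κ : Type*} [Fintype ι] [Fintype κ] [DecidableEq ι]
    [DecidableEq κ] {A : Matrix ι ι ℝ} {B : Matrix ι κ ℝ} {c p : ℝ} (hc : 0 ≤ c) (hp : 0 ≤ p)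
    (hp1 : p < 1) (hA : ∀ k, ‖A ^ k‖ ≤ c * p ^ k) {x : ℕ → ι → ℝ} {r : ℕ → κ → ℝ}
    (h : ∀ k, x (k + 1) = A *ᵥ x k + B *ᵥ r k) (k : ℕ) :
    ‖WithLp.toLp 2 (x k)‖ ≤ c * p ^ k * ‖WithLp.toLp 2 (x 0)‖ +
      c * ‖B‖ / (1 - p) * supBefore (fun j => WithLp.toLp 2 (r j)) k := by
  set σ := supBefore (fun j => WithLp.toLp 2 (r j)) k with hσ
  have hσ0 : 0 ≤ σ := supBefore_nonneg _ k
  rw [eq_pow_mulVec_add_sum h k, WithLp.toLp_add, WithLp.toLp_sum]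
  refine (norm_add_le _ _).trans (add_le_add ?_ ?_)
  · exact (norm_toLp_mulVec_le _ _).trans (mul_le_mul_of_nonneg_right (hA k) (norm_nonneg _))
  · have hterm (j : ℕ) (hj : j ∈ Finset.range k) :
        ‖WithLp.toLp 2 (A ^ (k - 1 - j) *ᵥ (B *ᵥ r j))‖ ≤ c * ‖B‖ * σ * p ^ (k - 1 - j) := by
      calc _ ≤ ‖A ^ (k - 1 - j)‖ * (‖B‖ * ‖WithLp.toLp 2 (r j)‖) :=
            (norm_toLp_mulVec_le _ _).trans
              (mul_le_mul_of_nonneg_left (norm_toLp_mulVec_le _ _) (norm_nonneg _))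
        _ ≤ (c * p ^ (k - 1 - j)) * (‖B‖ * σ) := by
            gcongr
            · exact hA _
            · exact norm_le_supBefore (fun j => WithLp.toLp 2 (r j)) (Finset.mem_range.mp hj)
        _ = _ := by ring
    calc _ ≤ ∑ j ∈ Finset.range k, c * ‖B‖ * σ * p ^ (k - 1 - j) := norm_sum_le_of_le _ hterm
      _ = c * ‖B‖ * σ * ∑ j ∈ Finset.range k, p ^ j := by
          rw [← Finset.mul_sum, Finset.sum_range_reflect (fun j => p ^ j) k]
      _ ≤ c * ‖B‖ * σ * (1 / (1 - p)) := by
          refine mul_le_mul_of_nonneg_left ?_ (by positivity)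
          rw [le_div_iff₀ (by linarith), geom_sum_mul_neg]
          linarith [pow_nonneg hp k]
      _ = _ := by ring

theorem isClassK_const_mul {a : ℝ} (ha : 0 < a) : IsClassK fun s => a * s :=
  ⟨by fun_prop, fun _ _ _ _ h => mul_lt_mul_of_pos_left h ha, mul_zero a⟩

theorem isClassKL_geometric {c p : ℝ} (hc : 0 < c) (hp : 0 < p) (hp1 : p < 1) :
    IsClassKL fun s k => c * p ^ k * s := by
  refine ⟨fun k => isClassK_const_mul (by positivity), fun s hs => ⟨fun j k hjk => ?_, ?_⟩⟩
  · exact mul_le_mul_of_nonneg_right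
      (mul_le_mul_of_nonneg_left (pow_le_pow_of_le_one hp.le hp1.le hjk) hc.le) hs
  · simpa using ((tendsto_pow_atTop_nhds_zero_of_lt_one hp.le hp1).const_mul c).mul_const s

/-- Makes the slope of `γ` positive, as class `K` demands. -/
theorem closedLoopB_ne_zero {n₁ n₂ : ℕ} (hn₁ : 0 < n₁) (Υhat : Matrix (Fin n₂) (Fin n₁) ℝ) :
    closedLoopB Υhat ≠ 0 := by
  intro h
  have := congrFun (congrFun h (Sum.inl ⟨0, hn₁⟩)) (Sum.inl ⟨0, hn₁⟩)
  simp [closedLoopB] at this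

theorem Signals.IsTrajectory.closedLoop_succ {n₁ n₂ m : ℕ} {s : Signals n₁ n₂ m}
    {S : Cascade n₁ n₂ m} (hs : s.IsTrajectory S) {N₁ : Matrix (Fin m) (Fin n₁) ℝ}
    {N₂ : Matrix (Fin m) (Fin n₂) ℝ} {Υ Υhat : Matrix (Fin n₂) (Fin n₁) ℝ}
    (hu : s.IsControlledBy N₁ N₂ Υhat) (hΥ : IsSylvesterSolution S N₁ Υ) (k : ℕ) :
    Sum.elim (s.xbar₁ (k + 1)) (s.xbar₂ (k + 1) - Υhat *ᵥ s.xbar₁ (k + 1)) =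
      closedLoopA S N₁ N₂ Υ Υhat *ᵥ Sum.elim (s.xbar₁ k) (s.xbar₂ k - Υhat *ᵥ s.xbar₁ k) +
        closedLoopB Υhat *ᵥ Sum.elim (s.r₁ S k) (s.r₂ S k) := by
  -- Eliminating `B₂` by the Sylvester equation turns the coefficient of `x̄₁` in the second row
  -- into an expression in `Υ - Υ̂`.
  have hB₂ : S.B₂ = Υ * (S.A₁ + S.B₁ * N₁) - S.A₂ * Υ := by rw [hΥ]; abel
  rw [hs.xbar₁_succ, hs.xbar₂_succ, hu k, closedLoopA, closedLoopB, Matrix.fromBlocks_mulVec,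
    Matrix.fromBlocks_mulVec, hB₂, ← Sum.elim_add_add]
  simp only [Sum.elim_comp_inl, Sum.elim_comp_inr]
  congr 1 <;>
  · simp only [Matrix.mulVec_add, Matrix.mulVec_sub, Matrix.add_mulVec, Matrix.sub_mulVec,
      ← Matrix.mulVec_mulVec, Matrix.neg_mulVec, Matrix.one_mulVec, Matrix.zero_mulVec,
      Matrix.mul_assoc]
    abel

end CascadeISS

open CascadeISS in
theorem mainTheorem1 {n₁ n₂ m T : ℕ} (hn₁ : 0 < n₁) (hn₂ : 0 < n₂)
    -- the cascade, and the experiment that generates the data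
    (S : Cascade n₁ n₂ m) (e : Signals n₁ n₂ m) (he : e.IsTrajectory S)
    -- the data matrices, and the data matrices of the encapsulated noise
    (U₁ : Matrix (Fin m) (Fin T) ℝ) (hU₁ : U₁ = dataMinus T e.u₁)
    (X₁m X₁p R₁ : Matrix (Fin n₁) (Fin T) ℝ) (hX₁m : X₁m = dataMinus T e.xbar₁)
    (hX₁p : X₁p = dataPlus T e.xbar₁) (hR₁ : R₁ = dataMinus T (e.r₁ S))
    (X₂m X₂p R₂ : Matrix (Fin n₂) (Fin T) ℝ) (hX₂m : X₂m = dataMinus T e.xbar₂)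
    (hX₂p : X₂p = dataPlus T e.xbar₂) (hR₂ : R₂ = dataMinus T (e.r₂ S))
    (hrank₁ : (Matrix.fromRows X₁m U₁).rank = n₁ + m)
    (hrank₂ : (Matrix.fromRows X₂m X₁m).rank = n₂ + n₁)
    -- design of `N₁`
    (α₁ : ℝ) (hα₁ : 0 < α₁) (hSNR₁ : SNRCondition α₁ R₁ X₁p)
    (Q₁ : Matrix (Fin T) (Fin n₁) ℝ) (hQ₁ : NoiseRobustLMI α₁ X₁m X₁p Q₁)
    (N₁ : Matrix (Fin m) (Fin n₁) ℝ) (hN₁ : N₁ = lmiGain U₁ X₁m Q₁)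
    (G : Matrix (Fin T) (Fin n₁) ℝ) (hG₁ : 1 = X₁m * G) (hG₂ : N₁ = U₁ * G)
    -- the Sylvester equation is uniquely solvable
    (hdisj : Disjoint (eigenvalues (S.A₁ + S.B₁ * N₁)) (eigenvalues S.A₂))
    -- the empirical solution of the Sylvester equation
    (Ghat : Matrix (Fin T) (Fin n₁) ℝ) (hGhat₁ : X₂p * Ghat = X₂m * Ghat * (X₁p * G))
    (hGhat₂ : X₁m * Ghat = 1)
    (Υhat : Matrix (Fin n₂) (Fin n₁) ℝ) (hΥhat : Υhat = X₂m * Ghat)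
    -- design of `N₂`
    (Zm Zp : Matrix (Fin n₂) (Fin T) ℝ) (hZm : Zm = X₂m - Υhat * X₁m)
    (hZp : Zp = X₂p - Υhat * X₁p)
    (V : Matrix (Fin m) (Fin T) ℝ) (hV : V = U₁ - N₁ * X₁m)
    (hrank₃ : (Matrix.fromRows Zm V).rank = n₂ + m)
    (α₂ : ℝ) (hα₂ : 0 < α₂) (hSNR₂ : SNRCondition α₂ (noiseZeta X₁m R₁ X₂m R₂ G Ghat) Zp)
    (Q₂ : Matrix (Fin T) (Fin n₂) ℝ) (hQ₂ : NoiseRobustLMI α₂ Zm Zp Q₂)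
    (N₂ : Matrix (Fin m) (Fin n₂) ℝ) (hN₂ : N₂ = lmiGain V Zm Q₂)
    -- the small-gain condition, in `[0, ∞]` with `1 / 0 = ∞`
    (hgain : ‖R₂ * Ghat - X₂m * Ghat * R₁ * G‖ₑ <
      1 / (‖S.B₁ * N₂‖ₑ * hInfNorm (resolventMatrix (S.A₁ + S.B₁ * N₁)) *
        hInfNorm (resolventMatrix (S.A₂ - Υhat * S.B₁ * N₂)))) :
    ∃ Υ : Matrix (Fin n₂) (Fin n₁) ℝ,
      (IsSylvesterSolution S N₁ Υ ∧ ∀ Θ, IsSylvesterSolution S N₁ Θ → Θ = Υ) ∧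
      IsSchur (closedLoopA S N₁ N₂ Υ Υhat) ∧
      ∃ c p : ℝ, 0 < c ∧ 0 ≤ p ∧ p < 1 ∧
        ∃ (β : ℝ → ℕ → ℝ) (γ : ℝ → ℝ),
          β = (fun s k => c * p ^ k * s) ∧ γ = (fun s => c * ‖closedLoopB Υhat‖ / (1 - p) * s) ∧
          IsClassKL β ∧ IsClassK γ ∧
          ∀ s : Signals n₁ n₂ m, s.IsTrajectory S → s.IsControlledBy N₁ N₂ Υhat →
            ∀ k : ℕ,
              ‖col (s.x₁ k) (s.x₂ k - Υhat *ᵥ s.x₁ k)‖ ≤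
                β ‖col (s.xbar₁ 0) (s.xbar₂ 0 - Υhat *ᵥ s.xbar₁ 0)‖ k +
                γ (supBefore (fun j => col (s.r₁ S j) (s.r₂ S j)) k) +
                ‖col (s.Δx₁ k) (s.Δx₂ k - Υhat *ᵥ s.Δx₁ k)‖ := by
  have : Nonempty (Fin n₁ ⊕ Fin n₂) := ⟨Sum.inl ⟨0, hn₁⟩⟩
  have hdata₁ : X₁p = S.A₁ * X₁m + S.B₁ * U₁ - R₁ := by
    rw [hX₁p, hX₁m, hU₁, hR₁, he.dataPlus_xbar₁]
  have hdata₂ : X₂p = S.A₂ * X₂m + S.B₂ * X₁m - R₂ := by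
    rw [hX₂p, hX₂m, hX₁m, hR₂, he.dataPlus_xbar₂]
  have hSchur₁ : IsSchur (S.A₁ + S.B₁ * N₁) := by
    rw [hN₁]
    exact isSchur_of_noiseRobustLMI hdata₁ hα₁ hSNR₁ hQ₁
  -- the defect of the empirical solution in the Sylvester equation
  have hdefect : S.B₂ = Υhat * (S.A₁ + S.B₁ * N₁) - S.A₂ * Υhat
      + (R₂ * Ghat - Υhat * R₁ * G) := by
    have hl : X₂p * Ghat = S.A₂ * Υhat + S.B₂ - R₂ * Ghat := by
      rw [hdata₂, Matrix.sub_mul, Matrix.add_mul, Matrix.mul_assoc, Matrix.mul_assoc, hGhat₂,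
        Matrix.mul_one, ← hΥhat]
    have hr : X₁p * G = S.A₁ + S.B₁ * N₁ - R₁ * G := by
      rw [hdata₁, Matrix.sub_mul, Matrix.add_mul, Matrix.mul_assoc, Matrix.mul_assoc, ← hG₁,
        ← hG₂, Matrix.mul_one]
    rw [hl, hr, ← hΥhat, Matrix.mul_sub, ← Matrix.mul_assoc] at hGhat₁
    rw [← sub_eq_zero] at hGhat₁ ⊢
    rw [← hGhat₁]
    abel
  -- The defect formula replaces `B₂`, so the terms in `x̄₁` combine into `Ẑ₋`, `V₋` and noise: the
  -- data equation of the second design.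
  have hdataζ : Zp = S.A₂ * Zm + (-(Υhat * S.B₁)) * V - noiseZeta X₁m R₁ X₂m R₂ G Ghat := by
    rw [noiseZeta, ← hΥhat, hZp, hZm, hV, hdata₂, hdata₁, hdefect]
    simp only [Matrix.mul_add, Matrix.add_mul, Matrix.mul_sub, Matrix.sub_mul, Matrix.neg_mul,
      Matrix.mul_assoc]
    abel
  have hSchur₂ : IsSchur (S.A₂ - Υhat * S.B₁ * N₂) := by
    rw [hN₂, sub_eq_add_neg, ← Matrix.neg_mul]
    exact isSchur_of_noiseRobustLMI hdataζ hα₂ hSNR₂ hQ₂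
  obtain ⟨Υ, hΥ, huniq⟩ := existsUnique_sylvester hdisj S.B₂
  have h₂₁ : (Υ - Υhat) * (S.A₁ + S.B₁ * N₁) - S.A₂ * (Υ - Υhat)
      = R₂ * Ghat - X₂m * Ghat * R₁ * G := by
    rw [Matrix.sub_mul, Matrix.mul_sub, hΥ, ← hΥhat]
    nth_rw 1 [hdefect]
    abel
  have hSchur : IsSchur (closedLoopA S N₁ N₂ Υ Υhat) := by
    rw [closedLoopA, h₂₁]
    exact isSchur_fromBlocks_of_smallGain hSchur₁ hSchur₂ (mul_lt_one_of_lt_one_div hgain)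
  obtain ⟨c, p, hc, hp, hp1, hpow⟩ := hSchur.exists_norm_pow_le
  have hB : 0 < ‖closedLoopB Υhat‖ := norm_pos_iff.mpr (closedLoopB_ne_zero hn₁ Υhat)
  have h1p : 0 < 1 - p := sub_pos.mpr hp1
  refine ⟨Υ, ⟨hΥ, huniq⟩, hSchur, c, p, hc, hp.le, hp1, _, _, rfl, rfl,
    isClassKL_geometric hc hp hp1, isClassK_const_mul (by positivity), fun s hs hu k => ?_⟩
  have hiss := norm_le_of_linear_recursion hc.le hp.le hp1 hpow
    (x := fun k => Sum.elim (s.xbar₁ k) (s.xbar₂ k - Υhat *ᵥ s.xbar₁ k))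
    (r := fun k => Sum.elim (s.r₁ S k) (s.r₂ S k)) (hs.closedLoop_succ hu hΥ) k
  -- The recursion only controls the measured state; the true state differs from it by the
  -- measurement noise, the last term of the bound.
  have hsplit : col (s.x₁ k) (s.x₂ k - Υhat *ᵥ s.x₁ k) =
      col (s.xbar₁ k) (s.xbar₂ k - Υhat *ᵥ s.xbar₁ k) -
        col (s.Δx₁ k) (s.Δx₂ k - Υhat *ᵥ s.Δx₁ k) := by
    rw [col, col, col, ← WithLp.toLp_sub, ← Sum.elim_sub_sub, Signals.xbar₁, Signals.xbar₂,
      Matrix.mulVec_add]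
    congr 2 <;> abel
  rw [hsplit]
  exact (norm_sub_le _ _).trans (add_le_add_left hiss _)
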